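/- Let $K$ be an algebraically closed field, let $k\ge 2$ and let $n_1,\dots,n_k\ge 1$ be integers. Let $K^{n_1,\dots,n_k}$ be the space of $k$-tensors (arrays) $T=(T_{j_1,\dots,j_k})$ with $j_i\in[n_i]$ and entries in $K$. For $S\in K^{m_1,\dots,m_k}$ and $T\in K^{n_1,\dots,n_k}$ write $S\le T$ if there are matrices $A^{(i)}\in K^{m_i\times n_i}$ $(1\le i\le k)$ with $$S_{j_1,\dots,j_k}=\sum_{a_1,\dots,a_k}A^{(1)}_{j_1,a_1}\cdots A^{(k)}_{j_k,a_k}\,T_{a_1,\dots,a_k}\qquad\text{for all } j_1,\dots,j_k .$$ Let $I_r\in K^{r,\dots,r}$ be the tensor of order $k$ with entries $1$ at the positions $(j,\dots,j)$ and $0$ elsewhere. The subrank ${\rm Q}(T)$ is the largest $r\ge 0$ with $I_r\le T$. Then there is exactly one integer $r$ such that ${\rm Q}(T)=r$ for all $T$ in some non-empty Zariski-open subset of $K^{n_1,\dots,n_k}$. This $r$, called the generic subrank and denoted ${\rm Q}(n_1,\dots,n_k)$, satisfies $${\rm Q}(n_1,\dots,n_k)\;\le\;\Bigl(\sum_{i=1}^k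 n_i-(k-1)\Bigr)^{\frac1{k-1}} .$$ -/

import Mathlib

namespace KTensor

/-- The space of `k`-tensors (`k`-dimensional arrays) of format `n 0 × ⋯ × n (k - 1)` over `K`. -/
abbrev Tensor (K : Type*) {k : ℕ} (n : Fin k → ℕ) : Type _ :=
  ((i : Fin k) → Fin (n i)) → K

/-- `(A₁ ⊗ ⋯ ⊗ A_k) T`: apply the matrices `A i` to the slices of `T`. -/
def applyMatrices {K : Type*} [Field K] {k : ℕ} {m n : Fin k → ℕ}
    (A : (i : Fin k) → Matrix (Fin (m i)) (Fin (n i)) K) (T : Tensor K n) : Tensor K m :=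
  fun x => ∑ y : (i : Fin k) → Fin (n i), (∏ i, A i (x i) (y i)) * T y

/-- The restriction preorder `S ≤ T` on `k`-tensors (of possibly different formats). -/
def Restricts {K : Type*} [Field K] {k : ℕ} {m n : Fin k → ℕ}
    (S : Tensor K m) (T : Tensor K n) : Prop :=
  ∃ A : (i : Fin k) → Matrix (Fin (m i)) (Fin (n i)) K, S = applyMatrices A T

/-- The diagonal tensor `I_r` of order `k` and format `r × ⋯ × r`. -/
def unitTensor (K : Type*) [Field K] (k r : ℕ) : Tensor K (fun _ : Fin k => r) :=
  fun x => if ∀ i j, x i = x j then 1 else 0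

/-- The subrank of `T`: the largest `r` such that `I_r ≤ T`.  For order `k ≥ 2` the maximum
exists, see `isGreatest_subrank`. -/
noncomputable def subrank {K : Type*} [Field K] {k : ℕ} {n : Fin k → ℕ} (T : Tensor K n) : ℕ :=
  sSup {r : ℕ | Restricts (unitTensor K k r) T}

/-- A subset of the affine space `K^σ` is Zariski-open if its complement is the common zero set
of finitely many polynomials. -/
def IsZariskiOpen {K : Type*} [Field K] {σ : Type*} (U : Set (σ → K)) : Prop :=
  ∃ P : Finset (MvPolynomial σ K), Uᶜ = {x | ∀ p ∈ P, MvPolynomial.eval x p = 0}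

/-- `r` is the value of the subrank on some non-empty Zariski-open set of tensors. -/
def IsGenericSubrank (K : Type*) [Field K] {k : ℕ} (n : Fin k → ℕ) (r : ℕ) : Prop :=
  ∃ U : Set (Tensor K n), IsZariskiOpen U ∧ U.Nonempty ∧ ∀ T ∈ U, subrank T = r

/-- The generic subrank `Q(n₁, …, n_k)`: the (unique) number `r` with `IsGenericSubrank K n r`,
see `genericSubrank_eq`. -/
noncomputable def genericSubrank (K : Type*) [Field K] {k : ℕ} (n : Fin k → ℕ) : ℕ :=
  sSup {r : ℕ | IsGenericSubrank K n r}

/-- For order at least two, `I_r ≤ T` forces `r` to be at most each dimension. -/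
theorem le_of_restricts {K : Type*} [Field K] {k : ℕ} (hk : 2 ≤ k) {n : Fin k → ℕ}
    (T : Tensor K n) {r : ℕ} (h : Restricts (unitTensor K k r) T) (i : Fin k) : r ≤ n i := by
  obtain ⟨A, hA⟩ := h
  have hli : LinearIndependent K (fun (j : Fin r) (a : Fin (n i)) => A i j a) := by
    rw [Fintype.linearIndependent_iff]
    intro c hc j
    obtain ⟨i', hi'⟩ : ∃ i' : Fin k, i' ≠ i := by
      have : Nontrivial (Fin k) := Fin.nontrivial_iff_two_le.mpr hk
      exact exists_ne i
    have hunit : ∀ j' : Fin r, unitTensor K k r (Function.update (fun _ => j) i j')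
        = if j' = j then 1 else 0 := by
      intro j'
      unfold unitTensor
      congr 1
      apply propext
      constructor
      · intro hx
        simpa [Function.update_of_ne hi'] using hx i i'
      · rintro rfl a b
        simp [Function.update_eq_self]
    have h1 : ∑ j' : Fin r, c j' * unitTensor K k r (Function.update (fun _ => j) i j') = c j := by
      simp [hunit]
    rw [← h1, hA]
    unfold applyMatrices
    simp_rw [Finset.mul_sum]
    rw [Finset.sum_comm]
    apply Finset.sum_eq_zero
    intro y _
    have hprod : ∀ j' : Fin r, c j' * ((∏ l, A l (Function.update (fun _ => j) i j' l) (y l)) * T y)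
        = (c j' * A i j' (y i)) * ((∏ l ∈ Finset.univ.erase i, A l j (y l)) * T y) := by
      intro j'
      rw [← Finset.mul_prod_erase Finset.univ _ (Finset.mem_univ i)]
      rw [Finset.prod_congr rfl (g := fun l => A l j (y l))]
      · simp only [Function.update_self]
        ring
      · intro l hl
        rw [Function.update_of_ne (Finset.ne_of_mem_erase hl)]
    simp_rw [hprod]
    rw [← Finset.sum_mul]
    have h2 := congrFun hc (y i)
    simp only [Finset.sum_apply, Pi.smul_apply, smul_eq_mul, Pi.zero_apply] at h2
    rw [h2, zero_mul]
  simpa using hli.fintype_card_le_finrank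

theorem isGreatest_subrank {K : Type*} [Field K] {k : ℕ} (hk : 2 ≤ k) {n : Fin k → ℕ}
    (T : Tensor K n) : IsGreatest {r : ℕ | Restricts (unitTensor K k r) T} (subrank T) := by
  have hb : BddAbove {r : ℕ | Restricts (unitTensor K k r) T} :=
    ⟨n ⟨0, by omega⟩, fun r hr => le_of_restricts hk T hr _⟩
  have h0 : Restricts (unitTensor K k 0) T :=
    ⟨fun _ => 0, funext fun x => (x ⟨0, by omega⟩).elim0⟩
  exact ⟨Nat.sSup_mem ⟨0, h0⟩ hb, fun r hr => le_csSup hb hr⟩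

/-- Two non-empty Zariski-open sets meet, so the generic subrank is unique. -/
theorem IsGenericSubrank.unique {K : Type*} [Field K] [Infinite K] {k : ℕ} {n : Fin k → ℕ}
    {r s : ℕ} (hr : IsGenericSubrank K n r) (hs : IsGenericSubrank K n s) : r = s := by
  obtain ⟨U, ⟨P, hP⟩, ⟨a, ha⟩, hU⟩ := hr
  obtain ⟨V, ⟨R, hR⟩, ⟨b, hb⟩, hV⟩ := hs
  have memU : ∀ x, x ∈ U ↔ ∃ p ∈ P, MvPolynomial.eval x p ≠ 0 := by
    intro x
    have := Set.ext_iff.mp hP x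
    simp only [Set.mem_compl_iff, Set.mem_ofPred_eq] at this
    rw [← not_iff_not, this]
    push Not
    rfl
  have memV : ∀ x, x ∈ V ↔ ∃ p ∈ R, MvPolynomial.eval x p ≠ 0 := by
    intro x
    have := Set.ext_iff.mp hR x
    simp only [Set.mem_compl_iff, Set.mem_ofPred_eq] at this
    rw [← not_iff_not, this]
    push Not
    rfl
  obtain ⟨p, hp, hpa⟩ := (memU a).1 ha
  obtain ⟨q, hq, hqb⟩ := (memV b).1 hb
  have hpq : p * q ≠ 0 := by
    apply mul_ne_zero
    · rintro rfl
      simp at hpa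
    · rintro rfl
      simp at hqb
  obtain ⟨x, hx⟩ : ∃ x, MvPolynomial.eval x (p * q) ≠ 0 := by
    by_contra hcon
    push Not at hcon
    exact hpq (MvPolynomial.funext fun x => by simpa using hcon x)
  rw [map_mul] at hx
  rw [← hU x ((memU x).2 ⟨p, hp, left_ne_zero_of_mul hx⟩),
    hV x ((memV x).2 ⟨q, hq, right_ne_zero_of_mul hx⟩)]

theorem genericSubrank_eq {K : Type*} [Field K] [Infinite K] {k : ℕ} {n : Fin k → ℕ}
    {r : ℕ} (hr : IsGenericSubrank K n r) : genericSubrank K n = r := by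
  have : {s : ℕ | IsGenericSubrank K n s} = {r} :=
    Set.eq_singleton_iff_unique_mem.mpr ⟨hr, fun s hs => IsGenericSubrank.unique hs hr⟩
  rw [genericSubrank, this, csSup_singleton]

end KTensor

/-! The proof is a dimension count on the incidence variety of pairs (T, A) with A·T = I_r. The
matrices have r·∑ n_i entries. Rescaling rows by scalars that multiply to 1 over the k factors
removes (k-1)·r of these parameters (`exists_normalized`). For fixed A the condition on T is r^k
independent linear equations (`linearIndependent_prod`). If the variety dominates tensor space, then
∏ n_i ≤ r·∑ n_i - (k-1)·r + ∏ n_i - r^k, and dividing by r gives the bound.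

The count is carried out with transcendence degrees: dominance yields a field containing a tensor
with algebraically independent entries that restricts to I_r (`pow_add_le_of_algebraicIndependent`).
Chevalley's theorem and the Nullstellensatz (`exists_lift_of_injective`) turn dominance into
restriction of general tensors over K, so a generic subrank exists. -/

namespace KTensor

/-! ### Transcendence degree and linear elimination -/

/-- Algebraically independent elements of a field generated by `s` number at most `#s`. -/
theorem card_le_of_mem_adjoin {K L : Type*} [Field K] [Field L] [Algebra K L] {Y : Type*}
    [Fintype Y] {T : Y → L} (hT : AlgebraicIndependent K T) (s : Finset L)
    (h : ∀ y, T y ∈ IntermediateField.adjoin K (s : Set L)) : Fintype.card Y ≤ s.card := by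
  let F := IntermediateField.adjoin K (s : Set L)
  let T' : Y → F := fun y => ⟨T y, h y⟩
  have hT' : AlgebraicIndependent K T' := AlgebraicIndependent.of_comp F.val hT
  let s' : Set F := Subtype.val ⁻¹' (s : Set L)
  have hs' : IntermediateField.adjoin K s' = ⊤ := by
    apply IntermediateField.map_injective F.val
    rw [IntermediateField.adjoin_map, ← AlgHom.fieldRange_eq_map, IntermediateField.fieldRange_val]
    congr 1
    ext x
    simp only [Set.mem_image]
    constructor
    · rintro ⟨a, ha, rfl⟩
      exact ha
    · intro hx
      exact ⟨⟨x, IntermediateField.subset_adjoin K _ hx⟩, hx, rfl⟩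
  -- Every element of `F` is a quotient of elements of this subalgebra, so `s'` bounds the
  -- transcendence degree.
  have halg : Algebra.IsAlgebraic (Algebra.adjoin K s') F := by
    constructor
    intro x
    have hx : x ∈ IntermediateField.adjoin K s' := by rw [hs']; trivial
    rw [IntermediateField.mem_adjoin_iff_div] at hx
    obtain ⟨a, ha, b, hb, rfl⟩ := hx
    rw [div_eq_mul_inv]
    exact (isAlgebraic_algebraMap (⟨a, ha⟩ : Algebra.adjoin K s')).mul
      (isAlgebraic_algebraMap (⟨b, hb⟩ : Algebra.adjoin K s')).inv
  have h1 := Algebra.IsAlgebraic.trdeg_le_cardinalMk K s' 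
  have h2 := hT'.lift_cardinalMk_le_trdeg
  have h3 : Cardinal.mk s' ≤ s.card := by
    rw [← Cardinal.mk_coe_finset]
    exact Cardinal.mk_le_of_injective (f := fun x : s' => (⟨x.1.1, x.2⟩ : s))
      fun a b hab => Subtype.ext (Subtype.ext (by simpa using hab))
  have h4 := h2.trans (Cardinal.lift_le.2 (h1.trans h3))
  simpa using h4

/-- A linear system of full rank over `E` satisfied by `T` expresses all entries of `T` rationally
in terms of `E` and the entries at some positions `Z`, with one position fewer per equation. -/
theorem exists_subset_mem_adjoin {E L : Type*} [Field E] [Field L] [Algebra E L] {X Y : Type*}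
    [Fintype X] [Fintype Y] (M : X → Y → E) (hM : LinearIndependent E M) (T : Y → L)
    (hT : ∀ x, ∃ c : E, ∑ y, M x y • T y = algebraMap E L c) :
    ∃ Z : Finset Y, Z.card + Fintype.card X = Fintype.card Y ∧
      ∀ y, T y ∈ IntermediateField.adjoin E (T '' (Z : Set Y)) := by
  classical
  let U := Submodule.span E (Set.range M)
  let v : Y → (Y → E) ⧸ U := fun y => U.mkQ (Pi.single y 1)
  -- The unit vectors contain a basis modulo the row space `U`; its indices form `Z`, and the
  -- dimension of the quotient gives the count.
  obtain ⟨κ, a, ha, hspan, hli⟩ := exists_linearIndependent' E v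
  have hv : Submodule.span E (Set.range v) = ⊤ := by
    have : Set.range v = U.mkQ '' Set.range (fun y : Y => (Pi.single y 1 : Y → E)) := by
      rw [← Set.range_comp]; rfl
    rw [this, ← Submodule.map_span]
    have h2 := (Pi.basisFun E Y).span_eq
    have h3 : (⇑(Pi.basisFun E Y)) = fun y : Y => (Pi.single y 1 : Y → E) := by
      ext1 y; simp
    rw [h3] at h2
    rw [h2, Submodule.map_top, Submodule.range_mkQ]
  have : Fintype κ := Fintype.ofInjective a ha
  have hcard : Fintype.card κ + Fintype.card X = Fintype.card Y := by
    have h1 := finrank_span_eq_card hli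
    rw [hspan, hv, finrank_top] at h1
    rw [← h1, ← finrank_span_eq_card hM, Submodule.finrank_quotient_add_finrank,
      Module.finrank_pi]
  refine ⟨Finset.univ.map ⟨a, ha⟩, by simpa using hcard, fun y => ?_⟩
  set F := IntermediateField.adjoin E (T '' ((Finset.univ.map ⟨a, ha⟩ : Finset Y) : Set Y))
  let φ : (Y → E) →ₗ[E] L := Fintype.linearCombination E T
  -- Coefficient vectors whose combination of the `T y` lies in `F`. They include `U` and the chosen
  -- unit vectors, hence everything.
  let N : Submodule E (Y → E) := (Subalgebra.toSubmodule F.toSubalgebra).comap φ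
  have hφ : ∀ y, φ (Pi.single y 1) = T y := fun y => by
    simp [φ, Fintype.linearCombination_apply_single]
  have hUN : U ≤ N := by
    rw [Submodule.span_le]
    rintro _ ⟨x, rfl⟩
    obtain ⟨c, hc⟩ := hT x
    change φ (M x) ∈ F
    rw [Fintype.linearCombination_apply, hc]
    exact F.algebraMap_mem c
  have hvN : v y ∈ N.map U.mkQ := by
    have h1 : v y ∈ Submodule.span E (Set.range (v ∘ a)) := by rw [hspan, hv]; trivial
    refine Submodule.span_le.2 ?_ h1
    rintro _ ⟨j, rfl⟩
    refine ⟨Pi.single (a j) 1, ?_, rfl⟩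
    change φ _ ∈ F
    rw [hφ]
    exact IntermediateField.subset_adjoin _ _ ⟨a j, by simp, rfl⟩
  obtain ⟨w, hw, hwy⟩ := hvN
  have hd : (Pi.single y 1 : Y → E) - w ∈ U := by
    rw [← Submodule.Quotient.mk_eq_zero, Submodule.Quotient.mk_sub, sub_eq_zero]
    exact hwy.symm
  have hy : (Pi.single y 1 : Y → E) ∈ N := by
    have := N.add_mem (hUN hd) hw
    rwa [sub_add_cancel] at this
  have hy' : φ (Pi.single y 1) ∈ F := hy
  rwa [hφ] at hy'

/-! ### Restrictions to the unit tensor over a field -/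

section

variable {L : Type*} [Field L] {k : ℕ} {n : Fin k → ℕ}

theorem unitTensor_update (hk : 2 ≤ k) {r : ℕ} (i : Fin k) (j j' : Fin r) :
    unitTensor L k r (Function.update (fun _ => j) i j') = if j' = j then 1 else 0 := by
  obtain ⟨i', hi'⟩ : ∃ i' : Fin k, i' ≠ i := by
    have : Nontrivial (Fin k) := Fin.nontrivial_iff_two_le.mpr hk
    exact exists_ne i
  unfold unitTensor
  congr 1
  apply propext
  constructor
  · intro hx
    simpa [Function.update_of_ne hi'] using hx i i'
  · rintro rfl a b
    simp [Function.update_eq_self]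

/-- Matrices restricting a tensor to the unit tensor are right invertible. -/
theorem exists_right_inverse (hk : 2 ≤ k) {r : ℕ} {T : Tensor L n}
    {A : (i : Fin k) → Matrix (Fin r) (Fin (n i)) L} (hA : unitTensor L k r = applyMatrices A T)
    (i : Fin k) : ∃ B : Matrix (Fin (n i)) (Fin r) L, A i * B = 1 := by
  classical
  -- Column j contracts `T` with row j of every other matrix; applying `A i` then gives entries of
  -- the unit tensor at (j, …, j', …, j).
  refine ⟨Matrix.of fun a j => ∑ y : (i : Fin k) → Fin (n i) with y i = a,
    (∏ l ∈ Finset.univ.erase i, A l j (y l)) * T y, ?_⟩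
  ext j' j
  rw [Matrix.mul_apply, Matrix.one_apply, ← unitTensor_update (L := L) hk i j j', hA]
  unfold applyMatrices
  rw [← Finset.sum_fiberwise Finset.univ (fun y : (i : Fin k) → Fin (n i) => y i)]
  refine Finset.sum_congr rfl fun a _ => ?_
  rw [Matrix.of_apply, Finset.mul_sum]
  refine Finset.sum_congr rfl fun y hy => ?_
  have h1 : ∏ l ∈ Finset.univ.erase i, A l (Function.update (fun _ => j) i j' l) (y l)
      = ∏ l ∈ Finset.univ.erase i, A l j (y l) :=
    Finset.prod_congr rfl fun l hl => by rw [Function.update_of_ne (Finset.ne_of_mem_erase hl)]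
  rw [← Finset.mul_prod_erase Finset.univ _ (Finset.mem_univ i), h1, Function.update_self,
    (Finset.mem_filter.1 hy).2, mul_assoc]

/-- The Kronecker product of right inverses is a right inverse of the Kronecker product. -/
theorem linearIndependent_prod {r : ℕ} {A : (i : Fin k) → Matrix (Fin r) (Fin (n i)) L}
    (hA : ∀ i, ∃ B : Matrix (Fin (n i)) (Fin r) L, A i * B = 1) :
    LinearIndependent L (fun (x : Fin k → Fin r) (y : (i : Fin k) → Fin (n i)) =>
      ∏ i, A i (x i) (y i)) := by
  classical
  choose B hB using hA
  rw [Fintype.linearIndependent_iff]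
  intro c hc z
  have h1 : ∑ y : (i : Fin k) → Fin (n i), (∑ x : Fin k → Fin r, c x * ∏ i, A i (x i) (y i)) *
      ∏ i, B i (y i) (z i) = 0 := by
    refine Finset.sum_eq_zero fun y _ => ?_
    have := congrFun hc y
    simp only [Finset.sum_apply, Pi.smul_apply, smul_eq_mul, Pi.zero_apply] at this
    rw [this, zero_mul]
  simp_rw [Finset.sum_mul] at h1
  rw [Finset.sum_comm] at h1
  have h2 : ∀ x : Fin k → Fin r, ∑ y : (i : Fin k) → Fin (n i),
      (c x * ∏ i, A i (x i) (y i)) * ∏ i, B i (y i) (z i) = if x = z then c x else 0 := by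
    intro x
    simp_rw [mul_assoc, ← Finset.prod_mul_distrib]
    rw [← Finset.mul_sum, ← Fintype.piFinset_univ,
      ← Finset.prod_univ_sum (fun i => (Finset.univ : Finset (Fin (n i))))
        (fun i a => A i (x i) a * B i a (z i))]
    have : ∀ i, ∑ a, A i (x i) a * B i a (z i) = if x i = z i then 1 else 0 := fun i => by
      rw [← Matrix.mul_apply, hB, Matrix.one_apply]
    simp_rw [this, Finset.prod_ite_zero]
    simp [funext_iff]
  simp_rw [h2] at h1
  simpa using h1

/-- Matrices restricting a tensor to the unit tensor can be rescaled so that in all but one of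
them every row contains an entry `1`. -/
theorem exists_normalized (hk : 2 ≤ k) {r : ℕ} {T : Tensor L n}
    (h : Restricts (unitTensor L k r) T) (i₀ : Fin k) :
    ∃ (A : (i : Fin k) → Matrix (Fin r) (Fin (n i)) L) (c : (i : Fin k) → Fin r → Fin (n i)),
      unitTensor L k r = applyMatrices A T ∧ ∀ i ≠ i₀, ∀ j, A i j (c i j) = 1 := by
  classical
  obtain ⟨A, hA⟩ := h
  have hne : ∀ i j, ∃ a, A i j a ≠ 0 := by
    intro i j
    obtain ⟨B, hB⟩ := exists_right_inverse hk hA i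
    by_contra hcon
    push Not at hcon
    have := congrFun (congrFun hB j) j
    rw [Matrix.mul_apply, Matrix.one_apply_eq] at this
    simp [hcon] at this
  choose c hc using hne
  -- The factor at `i₀` compensates the others, so diagonal entries are unchanged; off-diagonal
  -- entries are zero under any scaling.
  let μ : Fin k → Fin r → L := fun i j =>
    if i = i₀ then ∏ l ∈ Finset.univ.erase i₀, A l j (c l j) else (A i j (c i j))⁻¹
  refine ⟨fun i j a => μ i j * A i j a, c, ?_, fun i hi j => ?_⟩
  · funext x
    have h1 : applyMatrices (fun i j a => μ i j * A i j a) T x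
        = (∏ i, μ i (x i)) * applyMatrices A T x := by
      unfold applyMatrices
      rw [Finset.mul_sum]
      refine Finset.sum_congr rfl fun y _ => ?_
      rw [Finset.prod_mul_distrib]
      ring
    rw [h1, ← hA]
    by_cases hx : ∀ i j, x i = x j
    · have : ∏ i, μ i (x i) = 1 := by
        rw [← Finset.mul_prod_erase Finset.univ _ (Finset.mem_univ i₀)]
        simp only [μ, if_true]
        rw [← Finset.prod_mul_distrib]
        refine Finset.prod_eq_one fun l hl => ?_
        rw [if_neg (Finset.ne_of_mem_erase hl), hx i₀ l]
        exact mul_inv_cancel₀ (hc _ _)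
      rw [this, one_mul]
    · simp [unitTensor, hx]
  · simp only [μ, if_neg hi]
    exact inv_mul_cancel₀ (hc _ _)

/-- If the matrices `A` over `E` restrict `T` to the unit tensor, then `r ^ k` entries of `T` are
rational over `E` in the remaining ones. -/
theorem exists_subset_of_restricts {E : Type*} [Field E] [Algebra E L] (hk : 2 ≤ k) {r : ℕ}
    {T : Tensor L n} {A : (i : Fin k) → Matrix (Fin r) (Fin (n i)) E}
    (hA : unitTensor L k r = applyMatrices (fun i => (A i).map (algebraMap E L)) T) :
    ∃ Z : Finset ((i : Fin k) → Fin (n i)),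
      Z.card + r ^ k = Fintype.card ((i : Fin k) → Fin (n i)) ∧
      ∀ y, T y ∈ IntermediateField.adjoin E (T '' (Z : Set ((i : Fin k) → Fin (n i)))) := by
  have hM : LinearIndependent E (fun (x : Fin k → Fin r) (y : (i : Fin k) → Fin (n i)) =>
      ∏ i, A i (x i) (y i)) := by
    rw [Fintype.linearIndependent_iff]
    intro g hg x
    -- The right inverses involve `T` and exist only over `L`; independence descends to `E`.
    have hli := linearIndependent_prod (A := fun i => (A i).map (algebraMap E L))
      (exists_right_inverse hk hA)
    have hL := Fintype.linearIndependent_iff.1 hli (fun x => algebraMap E L (g x)) ?_ x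
    · exact (map_eq_zero _).1 hL
    · funext y
      have := congrArg (algebraMap E L) (congrFun hg y)
      simpa [Finset.sum_apply, Algebra.smul_def] using this
  have hT : ∀ x : Fin k → Fin r, ∃ c : E,
      ∑ y : (i : Fin k) → Fin (n i), (∏ i, A i (x i) (y i)) • T y = algebraMap E L c := by
    intro x
    refine ⟨unitTensor E k r x, ?_⟩
    have h1 : algebraMap E L (unitTensor E k r x) = unitTensor L k r x := by
      unfold unitTensor
      split_ifs <;> simp
    rw [h1, hA]
    unfold applyMatrices
    refine Finset.sum_congr rfl fun y _ => ?_
    simp [Algebra.smul_def]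
  obtain ⟨Z, hZ, hZT⟩ := exists_subset_mem_adjoin _ hM T hT
  exact ⟨Z, by simpa using hZ, hZT⟩

/-- If the `c i j`-entries of the matrices `A i`, `i ≠ i₀`, are equal to `1`, then few elements
generate the field generated by all entries of the matrices. -/
theorem exists_generators (K : Type*) [Field K] [Algebra K L] {r : ℕ} (i₀ : Fin k)
    (A : (i : Fin k) → Matrix (Fin r) (Fin (n i)) L) (c : (i : Fin k) → Fin r → Fin (n i))
    (hc : ∀ i ≠ i₀, ∀ j, A i j (c i j) = 1) :
    ∃ s : Finset L, s.card + (k - 1) * r ≤ r * ∑ i, n i ∧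
      ∀ i j a, A i j a ∈ IntermediateField.adjoin K (s : Set L) := by
  classical
  let f : Fin k × Fin r → (i : Fin k) × (Fin r × Fin (n i)) := fun p => ⟨p.1, p.2, c p.1 p.2⟩
  have hf : Function.Injective f := fun p q hpq => by
    have h1 : p.1 = q.1 := congrArg (fun x : (i : Fin k) × (Fin r × Fin (n i)) => x.1) hpq
    have h2 : p.2 = q.2 := congrArg (fun x : (i : Fin k) × (Fin r × Fin (n i)) => x.2.1) hpq
    exact Prod.ext h1 h2
  let e : (i : Fin k) × (Fin r × Fin (n i)) → L := fun p => A p.1 p.2.1 p.2.2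
  -- The positions normalized to 1; the other entries generate.
  let P : Finset ((i : Fin k) × (Fin r × Fin (n i))) :=
    ((Finset.univ.erase i₀) ×ˢ (Finset.univ : Finset (Fin r))).image f
  have hP : P.card = (k - 1) * r := by
    rw [Finset.card_image_of_injective _ hf]
    simp
  have hV : P.card + Pᶜ.card = r * ∑ i, n i := by
    rw [Finset.card_add_card_compl]
    simp [Finset.mul_sum]
  refine ⟨Pᶜ.image e, ?_, fun i j a => ?_⟩
  · have := Finset.card_image_le (s := Pᶜ) (f := e)
    omega
  · by_cases hp : (⟨i, j, a⟩ : (i : Fin k) × (Fin r × Fin (n i))) ∈ P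
    · obtain ⟨⟨i', j'⟩, hij, h⟩ := Finset.mem_image.1 hp
      have h1 : e ⟨i, j, a⟩ = 1 := by
        rw [← h]
        exact hc i' (by simpa using hij) j'
      change e ⟨i, j, a⟩ ∈ _
      rw [h1]
      exact one_mem _
    · exact IntermediateField.subset_adjoin K _
        (Finset.mem_coe.2 (Finset.mem_image_of_mem e (Finset.mem_compl.2 hp)))

/-- The dimension count: a tensor with algebraically independent entries restricts only to small
unit tensors. -/
theorem pow_add_le_of_algebraicIndependent {K : Type*} [Field K] [Algebra K L] (hk : 2 ≤ k) {r : ℕ}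
    (hr : 1 ≤ r) {T : Tensor L n} (hT : AlgebraicIndependent K T)
    (h : Restricts (unitTensor L k r) T) : r ^ (k - 1) + (k - 1) ≤ ∑ i, n i := by
  classical
  obtain ⟨A, c, hA, hc⟩ := exists_normalized hk h ⟨0, by omega⟩
  obtain ⟨s, hs, hAs⟩ := exists_generators K _ A c hc
  obtain ⟨Z, hZ, hZT⟩ := exists_subset_of_restricts
    (E := IntermediateField.adjoin K (s : Set L)) (T := T) hk
    (A := fun i => Matrix.of fun j a => ⟨A i j a, hAs i j a⟩) hA
  have hmem : ∀ y, T y ∈ IntermediateField.adjoin K ((s ∪ Z.image T : Finset L) : Set L) := by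
    intro y
    have := hZT y
    rw [← IntermediateField.mem_restrictScalars K, IntermediateField.adjoin_adjoin_left] at this
    simpa using this
  have hle := card_le_of_mem_adjoin hT _ hmem
  have h1 : (s ∪ Z.image T).card ≤ s.card + Z.card :=
    (Finset.card_union_le _ _).trans (add_le_add le_rfl Finset.card_image_le)
  have hX : r ^ k = r * r ^ (k - 1) := by
    rw [← pow_succ', Nat.sub_add_cancel (by omega)]
  -- The bound is proved after multiplication by r: `hle`, `h1`, `hs` and `hZ` combine and the
  -- number of tensor entries cancels.
  refine Nat.le_of_mul_le_mul_left ?_ (show 0 < r from hr)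
  rw [mul_add, mul_comm r (k - 1), ← hX]
  omega

end

/-! ### Generic points and lifting of rational points -/

open MvPolynomial

/-- A constructible set of primes of a domain that contains the generic point contains a non-empty
basic open set. -/
theorem exists_basicOpen_subset_of_isConstructible {R : Type*} [CommRing R] [IsDomain R]
    {s : Set (PrimeSpectrum R)} (hs : Topology.IsConstructible s) (h : ⊥ ∈ s) :
    ∃ f : R, f ≠ 0 ∧ (PrimeSpectrum.basicOpen f : Set (PrimeSpectrum R)) ⊆ s := by
  obtain ⟨S, rfl⟩ := PrimeSpectrum.exists_constructibleSetData_iff.2 hs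
  simp only [PrimeSpectrum.ConstructibleSetData.toSet, Set.mem_iUnion] at h
  obtain ⟨C, hC, hg, hf⟩ := h
  have hf0 : C.f ≠ 0 := by
    intro h0
    exact hf (by simp [h0])
  refine ⟨C.f, hf0, fun p hp => ?_⟩
  simp only [PrimeSpectrum.ConstructibleSetData.toSet, Set.mem_iUnion]
  refine ⟨C, hC, ?_, ?_⟩
  -- The closed condition holds at the generic point, so its equations are all zero.
  · rw [PrimeSpectrum.mem_zeroLocus] at hg ⊢
    intro x hx
    have : x ∈ (⊥ : Ideal R) := hg hx
    rw [Ideal.mem_bot.1 this]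
    exact zero_mem _
  · simpa [PrimeSpectrum.mem_zeroLocus] using hp

/-- A non-zero algebra of finite type over an algebraically closed field has a rational point. -/
theorem nonempty_algHom_of_finiteType (K A : Type*) [Field K] [IsAlgClosed K] [CommRing A]
    [Algebra K A] [Algebra.FiniteType K A] [Nontrivial A] : Nonempty (A →ₐ[K] K) := by
  obtain ⟨m, hm⟩ := Ideal.exists_maximal A
  let := Ideal.Quotient.field m
  have : Module.Finite K (A ⧸ m) := finite_of_finite_type_of_isJacobsonRing K (A ⧸ m)
  have hb := IsAlgClosed.algebraMap_bijective_of_isIntegral (k := K) (K := A ⧸ m)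
  exact ⟨((AlgEquiv.ofBijective (Algebra.ofId K (A ⧸ m)) hb).symm : (A ⧸ m) →ₐ[K] K).comp
    (Ideal.Quotient.mkₐ K m)⟩

/-- If `S` is finitely presented over `K[Y]` and contains it, then general points of `K^Y` lift to
points of `S`. -/
theorem exists_lift_of_injective {K Y S : Type*} [Field K] [IsAlgClosed K] [Finite Y] [CommRing S]
    [Algebra (MvPolynomial Y K) S] [Algebra.FinitePresentation (MvPolynomial Y K) S]
    (hinj : Function.Injective (algebraMap (MvPolynomial Y K) S)) :
    ∃ f : MvPolynomial Y K, f ≠ 0 ∧ ∀ t : Y → K, eval t f ≠ 0 →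
      ∃ g : S →+* K, g.comp (algebraMap (MvPolynomial Y K) S) = eval t := by
  have hc := PrimeSpectrum.isConstructible_range_comap
    (f := algebraMap (MvPolynomial Y K) S) (RingHom.finitePresentation_algebraMap.2 inferInstance)
  have hbot : ⊥ ∈ Set.range (PrimeSpectrum.comap (algebraMap (MvPolynomial Y K) S)) := by
    obtain ⟨p, hp, hpc⟩ := Ideal.exists_comap_eq_of_mem_minimalPrimes_of_injective hinj ⊥
      (by rw [IsDomain.minimalPrimes_eq_singleton_bot]; rfl)
    exact ⟨⟨p, hp⟩, PrimeSpectrum.ext hpc⟩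
  obtain ⟨f, hf0, hf⟩ := exists_basicOpen_subset_of_isConstructible hc hbot
  refine ⟨f, hf0, fun t ht => ?_⟩
  -- The maximal ideal of the point `t` lies in the image, so some prime `q` lies over it.
  obtain ⟨q, hq⟩ := hf (show (⟨RingHom.ker (eval t), RingHom.ker_isPrime _⟩ :
    PrimeSpectrum (MvPolynomial Y K)) ∈ PrimeSpectrum.basicOpen f from ht)
  have hq' : q.asIdeal.comap (algebraMap (MvPolynomial Y K) S) = RingHom.ker (eval t) :=
    congrArg PrimeSpectrum.asIdeal hq
  let φ : MvPolynomial Y K →+* S ⧸ q.asIdeal :=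
    (Ideal.Quotient.mk q.asIdeal).comp (algebraMap (MvPolynomial Y K) S)
  let : Algebra K (S ⧸ q.asIdeal) := (φ.comp C).toAlgebra
  have hft : Algebra.FiniteType K (S ⧸ q.asIdeal) := by
    have h1 : φ.FiniteType := (RingHom.FiniteType.of_surjective _
      Ideal.Quotient.mk_surjective).comp (RingHom.finiteType_algebraMap.2 inferInstance)
    have h2 : (C : K →+* MvPolynomial Y K).FiniteType :=
      RingHom.finiteType_algebraMap.2 (inferInstance : Algebra.FiniteType K (MvPolynomial Y K))
    exact RingHom.finiteType_algebraMap.1 (h1.comp h2)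
  obtain ⟨g⟩ := nonempty_algHom_of_finiteType K (S ⧸ q.asIdeal)
  refine ⟨g.toRingHom.comp (Ideal.Quotient.mk q.asIdeal), ?_⟩
  have hC : ∀ a, φ (C a) = algebraMap K (S ⧸ q.asIdeal) a := fun a => rfl
  change g.toRingHom.comp φ = eval t
  refine MvPolynomial.ringHom_ext (fun a => ?_) fun y => ?_
  · change g (φ (C a)) = _
    rw [hC, g.commutes]
    simp
  · have hy : X y - C (t y) ∈ RingHom.ker (eval t) := by simp [RingHom.mem_ker]
    rw [← hq'] at hy
    have h0 : φ (X y - C (t y)) = 0 := Ideal.Quotient.eq_zero_iff_mem.2 hy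
    rw [map_sub, sub_eq_zero] at h0
    change g (φ (X y)) = _
    rw [h0, hC, g.commutes]
    simp

/-- If `S` contains the domain `R`, then some ring homomorphism from `S` to a field is injective
on `R`. -/
theorem exists_field_of_injective {R : Type*} {S : Type*} [CommRing R] [IsDomain R] [CommRing S]
    {f : R →+* S} (hf : Function.Injective f) :
    ∃ p : Ideal S, ∃ _ : p.IsPrime, Function.Injective
      ((algebraMap (S ⧸ p) (FractionRing (S ⧸ p))).comp ((Ideal.Quotient.mk p).comp f)) := by
  obtain ⟨p, hp, hpc⟩ := Ideal.exists_comap_eq_of_mem_minimalPrimes_of_injective hf ⊥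
    (by rw [IsDomain.minimalPrimes_eq_singleton_bot]; rfl)
  refine ⟨p, hp, ?_⟩
  refine (IsFractionRing.injective (S ⧸ p) (FractionRing (S ⧸ p))).comp ?_
  change Function.Injective ((Ideal.Quotient.mk p).comp f)
  rw [RingHom.injective_iff_ker_eq_bot, ← RingHom.comap_ker, Ideal.mk_ker, hpc]

/-! ### The incidence variety and the generic subrank -/

section

variable (K : Type*) [Field K] {k : ℕ} (n : Fin k → ℕ) (r : ℕ)

/-- The coordinate ring of the space of tensors. -/
abbrev CoordRing : Type _ := MvPolynomial ((i : Fin k) → Fin (n i)) K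

/-- The polynomial ring over the coordinate ring of the space of tensors in the entries of matrices
of formats `r × n i`. -/
abbrev MatrixRing : Type _ := MvPolynomial ((i : Fin k) × (Fin r × Fin (n i))) (CoordRing K n)

/-- The `x`-entry of the equation stating that the matrices map the tensor to the unit tensor. -/
noncomputable def restrictionEquation (x : Fin k → Fin r) : MatrixRing K n r :=
  (∑ y : (i : Fin k) → Fin (n i),
    (∏ i, X (⟨i, x i, y i⟩ : (i : Fin k) × (Fin r × Fin (n i)))) * C (X y)) -
    if ∀ i j, x i = x j then 1 else 0

/-- The ideal of the incidence variety of tensors and matrices mapping them to the unit tensor. -/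
noncomputable def restrictionIdeal : Ideal (MatrixRing K n r) :=
  Ideal.span (Set.range (restrictionEquation K n r))

/-- The coordinate ring of the incidence variety. -/
abbrev IncidenceRing : Type _ := MatrixRing K n r ⧸ restrictionIdeal K n r

/-- Needed for Chevalley's theorem. -/
instance : Algebra.FinitePresentation (CoordRing K n) (IncidenceRing K n r) :=
  Algebra.FinitePresentation.quotient
    ((Submodule.fg_span (Set.finite_range (restrictionEquation K n r))))

variable {K n r}

/-- A point of the incidence variety over a field `L` is a tensor over `L` with a restriction to
the unit tensor. -/
theorem restricts_of_ringHom {L : Type*} [Field L] (g : IncidenceRing K n r →+* L) :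
    Restricts (unitTensor L k r)
      (fun y => g (algebraMap (CoordRing K n) (IncidenceRing K n r) (X y)) : Tensor L n) := by
  let g' : MatrixRing K n r →+* L := g.comp (Ideal.Quotient.mk (restrictionIdeal K n r))
  refine ⟨fun i => Matrix.of fun j a => g' (X ⟨i, j, a⟩), funext fun x => ?_⟩
  have h0 : g' (restrictionEquation K n r x) = 0 := by
    have hmem : restrictionEquation K n r x ∈ restrictionIdeal K n r :=
      Ideal.subset_span ⟨x, rfl⟩
    rw [RingHom.comp_apply, Ideal.Quotient.eq_zero_iff_mem.2 hmem, map_zero]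
  rw [restrictionEquation, map_sub, sub_eq_zero, map_sum] at h0
  have h1 : g' (if ∀ i j, x i = x j then 1 else 0) = unitTensor L k r x := by
    unfold unitTensor
    split_ifs <;> simp
  rw [← h1, ← h0]
  unfold applyMatrices
  refine Finset.sum_congr rfl fun y _ => ?_
  rw [map_mul, map_prod]
  rfl

/-- A polynomial in the ideal of the incidence variety vanishes at all tensors that restrict to
the unit tensor. -/
theorem eval_eq_zero_of_restricts {t : Tensor K n} (h : Restricts (unitTensor K k r) t)
    {f : CoordRing K n} (hf : algebraMap (CoordRing K n) (IncidenceRing K n r) f = 0) :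
    eval t f = 0 := by
  obtain ⟨A, hA⟩ := h
  let φ : MatrixRing K n r →+* K := eval₂Hom (eval t) fun p => A p.1 p.2.1 p.2.2
  have hle : restrictionIdeal K n r ≤ RingHom.ker φ := by
    rw [restrictionIdeal, Ideal.span_le]
    rintro _ ⟨x, rfl⟩
    have h1 : φ (if ∀ i j, x i = x j then 1 else 0) = unitTensor K k r x := by
      unfold unitTensor
      split_ifs <;> simp
    rw [SetLike.mem_coe, RingHom.mem_ker, restrictionEquation, map_sub, h1, hA, sub_eq_zero,
      map_sum]
    unfold applyMatrices
    refine Finset.sum_congr rfl fun y _ => ?_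
    simp [φ]
  have hmem : (C f : MatrixRing K n r) ∈ restrictionIdeal K n r :=
    Ideal.Quotient.eq_zero_iff_mem.1 hf
  have := hle hmem
  simpa [RingHom.mem_ker, φ] using this

/-- A larger unit tensor restricts to a smaller one. -/
theorem restricts_of_le {T : Tensor K n} {s : ℕ} (hrs : r ≤ s)
    (h : Restricts (unitTensor K k s) T) : Restricts (unitTensor K k r) T := by
  obtain ⟨A, hA⟩ := h
  refine ⟨fun i => Matrix.of fun j a => A i (Fin.castLE hrs j) a, funext fun x => ?_⟩
  have h1 := congrFun hA fun i => Fin.castLE hrs (x i)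
  have h2 : unitTensor K k r x = unitTensor K k s fun i => Fin.castLE hrs (x i) := by
    simp [unitTensor]
  rw [h2, h1]
  rfl

/-- General tensors restrict to the unit tensor if the incidence variety dominates the space of
tensors. -/
theorem exists_restricts_of_injective [IsAlgClosed K]
    (h : Function.Injective (algebraMap (CoordRing K n) (IncidenceRing K n r))) :
    ∃ f : CoordRing K n, f ≠ 0 ∧ ∀ t : Tensor K n, eval t f ≠ 0 →
      Restricts (unitTensor K k r) t := by
  obtain ⟨f, hf0, hf⟩ := exists_lift_of_injective (S := IncidenceRing K n r) h
  refine ⟨f, hf0, fun t ht => ?_⟩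
  obtain ⟨g, hg⟩ := hf t ht
  have h1 : (fun y => g (algebraMap (CoordRing K n) (IncidenceRing K n r) (X y)) : Tensor K n)
      = t := by
    funext y
    have := congrArg (fun φ : CoordRing K n →+* K => φ (X y)) hg
    simpa using this
  rw [← h1]
  exact restricts_of_ringHom g

/-- The dimension bound for dominant incidence varieties. -/
theorem pow_add_le_of_injective (hk : 2 ≤ k) (hr : 1 ≤ r)
    (h : Function.Injective (algebraMap (CoordRing K n) (IncidenceRing K n r))) :
    r ^ (k - 1) + (k - 1) ≤ ∑ i, n i := by
  obtain ⟨p, hp, hinj⟩ := exists_field_of_injective (R := CoordRing K n)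
    (S := IncidenceRing K n r) (f := algebraMap (CoordRing K n) (IncidenceRing K n r)) h
  let g : IncidenceRing K n r →+* FractionRing (IncidenceRing K n r ⧸ p) :=
    (algebraMap _ _).comp (Ideal.Quotient.mk p)
  let ψ : CoordRing K n →+* FractionRing (IncidenceRing K n r ⧸ p) :=
    g.comp (algebraMap (CoordRing K n) (IncidenceRing K n r))
  -- With K acting through constants, `ψ` is evaluation at the generic tensor, and its injectivity
  -- is algebraic independence.
  let : Algebra K (FractionRing (IncidenceRing K n r ⧸ p)) := (ψ.comp C).toAlgebra
  refine pow_add_le_of_algebraicIndependent (K := K) hk hr ?_ (restricts_of_ringHom g)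
  have : (aeval (R := K) fun y => g (algebraMap (CoordRing K n) (IncidenceRing K n r) (X y)) :
      CoordRing K n → _) = ψ := by
    funext q
    have h1 : (aeval (R := K) fun y => g (algebraMap (CoordRing K n) (IncidenceRing K n r) (X y)) :
        CoordRing K n →ₐ[K] _).toRingHom = ψ := by
      refine MvPolynomial.ringHom_ext (fun a => ?_) fun y => ?_
      · simp [RingHom.algebraMap_toAlgebra]
      · simp [ψ]
    exact congrArg (fun φ : CoordRing K n →+* _ => φ q) h1
  rw [AlgebraicIndependent, this]
  exact hinj

/-- The generic subrank exists and obeys the dimension bound. -/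
theorem exists_isGenericSubrank [IsAlgClosed K] (hk : 2 ≤ k) (n : Fin k → ℕ) :
    ∃ r, IsGenericSubrank K n r ∧ (1 ≤ r → r ^ (k - 1) + (k - 1) ≤ ∑ i, n i) := by
  classical
  let D : Set ℕ := {r | ∃ f : CoordRing K n, f ≠ 0 ∧ ∀ t : Tensor K n, eval t f ≠ 0 →
      Restricts (unitTensor K k r) t}
  have hpt : ∀ f : CoordRing K n, f ≠ 0 → ∃ t : Tensor K n, eval t f ≠ 0 := by
    intro f hf
    by_contra hcon
    push Not at hcon
    exact hf (MvPolynomial.funext fun x => by simpa using hcon x)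
  have hD : BddAbove D := by
    refine ⟨n ⟨0, by omega⟩, ?_⟩
    rintro r ⟨f, hf0, hf⟩
    obtain ⟨t, ht⟩ := hpt f hf0
    exact le_of_restricts hk t (hf t ht) _
  have h0 : 0 ∈ D := ⟨1, one_ne_zero, fun t _ =>
    ⟨fun _ => 0, funext fun x => (x ⟨0, by omega⟩).elim0⟩⟩
  obtain ⟨f, hf0, hf⟩ := Nat.sSup_mem ⟨0, h0⟩ hD
  -- By maximality, the next incidence variety is not dominant: some nonzero `f'` vanishes on all
  -- tensors restricting to the larger unit tensor.
  have hsucc : ¬ Function.Injective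
      (algebraMap (CoordRing K n) (IncidenceRing K n (sSup D + 1))) := fun h => by
    have := le_csSup hD (exists_restricts_of_injective h)
    omega
  rw [injective_iff_map_eq_zero] at hsucc
  push Not at hsucc
  obtain ⟨f', hf', hf'0⟩ := hsucc
  obtain ⟨t, ht⟩ := hpt (f * f') (mul_ne_zero hf0 hf'0)
  refine ⟨sSup D, ⟨{t | eval t (f * f') ≠ 0}, ⟨{f * f'}, ?_⟩, ⟨t, ht⟩, fun t ht => ?_⟩,
    fun hr => ?_⟩
  · ext t
    simp only [Set.mem_compl_iff, Set.mem_ofPred_eq, not_not, Finset.mem_singleton, forall_eq]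
  · have ht' : eval t (f * f') ≠ 0 := ht
    rw [map_mul] at ht'
    obtain ⟨hmem, hmax⟩ := isGreatest_subrank hk t
    refine le_antisymm ?_ (hmax (hf t (left_ne_zero_of_mul ht')))
    by_contra hlt
    exact right_ne_zero_of_mul ht'
      (eval_eq_zero_of_restricts (restricts_of_le (by omega) hmem) hf')
  · refine pow_add_le_of_injective (K := K) hk hr
      ((injective_iff_map_eq_zero (algebraMap (CoordRing K n) _)).2 fun q hq => ?_)
    by_contra hq0
    obtain ⟨t, ht⟩ := hpt (f * q) (mul_ne_zero hf0 hq0)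
    rw [map_mul] at ht
    exact right_ne_zero_of_mul ht (eval_eq_zero_of_restricts (hf t (left_ne_zero_of_mul ht)) hq)

end

end KTensor

theorem theorem1p4 {K : Type*} [Field K] [IsAlgClosed K] {k : ℕ} (hk : 2 ≤ k)
    (n : Fin k → ℕ) (hn : ∀ i, 1 ≤ n i) :
    (∃! r : ℕ, KTensor.IsGenericSubrank K n r) ∧
      (KTensor.genericSubrank K n : ℝ) ≤
        ((∑ i, (n i : ℝ)) - ((k : ℝ) - 1)) ^ (1 / ((k : ℝ) - 1)) := by
  obtain ⟨r, hr, hbound⟩ := KTensor.exists_isGenericSubrank (K := K) hk n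
  refine ⟨⟨r, hr, fun s hs => hs.unique hr⟩, ?_⟩
  rw [KTensor.genericSubrank_eq hr]
  have hsum : (k : ℝ) ≤ ∑ i, (n i : ℝ) := by
    have : ∑ _i : Fin k, (1 : ℝ) ≤ ∑ i, (n i : ℝ) :=
      Finset.sum_le_sum fun i _ => by exact_mod_cast hn i
    simpa using this
  have hk' : ((k - 1 : ℕ) : ℝ) = (k : ℝ) - 1 := by
    rw [Nat.cast_sub (by omega), Nat.cast_one]
  have hle : (r : ℝ) ^ (k - 1) ≤ (∑ i, (n i : ℝ)) - ((k : ℝ) - 1) := by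
    -- For r = 0 the count says nothing; the right side is nonnegative because every n_i ≥ 1.
    rcases Nat.eq_zero_or_pos r with rfl | hr0
    · rw [Nat.cast_zero, zero_pow (by omega)]
      linarith
    · have h1 : (r : ℝ) ^ (k - 1) + ((k - 1 : ℕ) : ℝ) ≤ ∑ i, (n i : ℝ) := by
        exact_mod_cast hbound hr0
      rw [hk'] at h1
      linarith
  rw [← hk', one_div]
  rw [← hk'] at hle
  calc (r : ℝ) = ((r : ℝ) ^ (k - 1)) ^ (((k - 1 : ℕ) : ℝ)⁻¹) :=
        (Real.pow_rpow_inv_natCast (Nat.cast_nonneg r) (by omega)).symm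
    _ ≤ _ := Real.rpow_le_rpow (by positivity) hle (by positivity)
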